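/- Let $\mathcal H$ be a complex separable Hilbert space, let $A\in\mathcal B(\mathcal H)$ be normal, and let $g^i\in\mathcal H$ for $i\in I$, where $I$ is a countable (finite or infinite) index set. A family $\{v_k\}$ in $\mathcal H$ is a frame if there are $0<c\le C<\infty$ with $c\|f\|^2\le\sum_k|\langle f,v_k\rangle|^2\le C\|f\|^2$ for all $f\in\mathcal H$, and $\{e^{tA}g^i\}_{i\in I,\,t\in[0,\infty)}$ is a semi-continuous frame if there are $0<c\le C<\infty$ with $c\|f\|^2\le\sum_{i\in I}\int_0^\infty|\langle f,e^{tA}g^i\rangle|^2\,dt\le C\|f\|^2$ for all $f\in\mathcal H$. Let $\mathfrak h(z)=\frac{1-z}{1+z}$. Let $U$ be any unitary as in the spectral theorem with multiplicity for the normal operator $-A$, that is, $$U:\mathcal H\to (L^2(\mu_\infty))^{(\infty)}\oplus L^2(\mu_1)\oplus (L^2(\mu_2))^{(2)}\oplus\cdots$$ with mutually singular non-negative regular Borel measures $\mu_j$ ($1\le j\le\infty$) on $\mathbb C$, such that $U(-A)U^{-1}$ is multiplication by $z$. Then the following are equivalent: 1. $\{e^{tA}g^i\}_{i\in I,\,t\in[0,\infty)}$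 is a semi-continuous frame for $\mathcal H$; 2. $-1\notin\sigma(-A)$ (so that $\mathfrak h(-A)=(I+A)(I-A)^{-1}$ is a well-defined bounded operator), and $\{(\mathfrak h(-A))^n a^i\}_{i\in I,\,n\in\mathbb N\cup\{0\}}$ is a frame for $\mathcal H$, where the vectors $a^i\in\mathcal H$ are given by $(Ua^i)(z)=\frac{\sqrt2}{1+z}(Ug^i)(z)$ (almost everywhere, in each component). The same equivalence holds, without reference to $U$, with $a^i=\sqrt2\,(I-A)^{-1}g^i$. -/

import Mathlib

open MeasureTheory
open scoped ENNReal NNReal InnerProductSpace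

/-- `v` is a (discrete) frame: `c ‖f‖² ≤ ∑ |⟨f, v i⟩|² ≤ C ‖f‖²` for all `f`, with `0 < c, C < ∞`.
The sum is taken in `[0, ∞]`, so no summability is presupposed. -/
def IsFrame {H : Type*} [NormedAddCommGroup H] [InnerProductSpace ℂ H] {ι : Type*}
    (v : ι → H) : Prop :=
  ∃ c C : ℝ≥0, 0 < c ∧ 0 < C ∧ ∀ f : H,
    (c : ℝ≥0∞) * ‖f‖ₑ ^ 2 ≤ ∑' i, ‖⟪f, v i⟫_ℂ‖ₑ ^ 2 ∧
    ∑' i, ‖⟪f, v i⟫_ℂ‖ₑ ^ 2 ≤ (C : ℝ≥0∞) * ‖f‖ₑ ^ 2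

/-- `{v i t}`, `i : ι`, `t ∈ [0, ∞)`, is a semi-continuous frame:
`c ‖f‖² ≤ ∑ i, ∫₀^∞ |⟨f, v i t⟩|² dt ≤ C ‖f‖²` for all `f`, with `0 < c, C < ∞`. -/
def IsSemiContinuousFrame {H : Type*} [NormedAddCommGroup H] [InnerProductSpace ℂ H] {ι : Type*}
    (v : ι → ℝ → H) : Prop :=
  ∃ c C : ℝ≥0, 0 < c ∧ 0 < C ∧ ∀ f : H,
    (c : ℝ≥0∞) * ‖f‖ₑ ^ 2 ≤ ∑' i, ∫⁻ t in Set.Ici (0 : ℝ), ‖⟪f, v i t⟫_ℂ‖ₑ ^ 2 ∧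
    ∑' i, ∫⁻ t in Set.Ici (0 : ℝ), ‖⟪f, v i t⟫_ℂ‖ₑ ^ 2 ≤ (C : ℝ≥0∞) * ‖f‖ₑ ^ 2

/-- `𝔥(B) = (1 - B)(1 + B)⁻¹`, where `𝔥(z) = (1 - z) / (1 + z)`, for a bounded operator `B` such
that `1 + B` is invertible (that is, `-1 ∉ σ(B)`). -/
noncomputable def cayleyOp {H : Type*} [NormedAddCommGroup H] [InnerProductSpace ℂ H]
    (B : H →L[ℂ] H) : H →L[ℂ] H :=
  (1 - B) * Ring.inverse (1 + B)

/-- The multiplicities `1 ≤ j ≤ ∞`. -/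
abbrev Multiplicity : Type := {j : ℕ∞ // 1 ≤ j}

/-- An index set `{0, …, j - 1}` with exactly `j` elements (all of `ℕ` if `j = ∞`). -/
abbrev MultiplicityIndex (j : Multiplicity) : Type := {k : ℕ // (k : ℕ∞) < j.1}

/-- The Hilbert direct sum `L²(μ_∞)^(∞) ⊕ L²(μ_1) ⊕ L²(μ_2)^(2) ⊕ ⋯`: its components are indexed by
the pairs `⟨j, k⟩` of a multiplicity `1 ≤ j ≤ ∞` and an index `k < j` of a copy of `L²(μ_j)`. -/
abbrev MultiplicitySpace (μ : Multiplicity → Measure ℂ) : Type :=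
  lp (fun p : (Σ j : Multiplicity, MultiplicityIndex j) => Lp ℂ 2 (μ p.1)) 2

/-- A representation of `B` as provided by the spectral theorem with multiplicity: mutually singular
non-negative regular Borel measures `μ_j`, `1 ≤ j ≤ ∞`, on `ℂ`, and a unitary `U` of `H` onto
`L²(μ_∞)^(∞) ⊕ L²(μ_1) ⊕ L²(μ_2)^(2) ⊕ ⋯` that carries `B` to multiplication by `z`. -/
structure SpectralMultiplicityRep {H : Type*} [NormedAddCommGroup H] [InnerProductSpace ℂ H]
    (B : H →L[ℂ] H) where
  μ : Multiplicity → Measure ℂ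
  regular : ∀ j, (μ j).Regular
  mutuallySingular : ∀ i j, i ≠ j → (μ i).MutuallySingular (μ j)
  U : H ≃ₗᵢ[ℂ] MultiplicitySpace μ
  intertwines : ∀ (f : H) (p : Σ j : Multiplicity, MultiplicityIndex j),
    (U (B f) p : ℂ → ℂ) =ᵐ[μ p.1] fun z => z * (U f p : ℂ → ℂ) z

/-! Fix one generator `g` and put `a = √2 (1 - A)⁻¹ g`. If the orbit of either vector is Bessel, its
frame form is `‖T f‖²` with `T` its analysis operator. Moving along the semigroup by `s` removes the
integral over `[0, s)`, so the continuous form solves a Lyapunov equation; applying `C*`, with `C`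
the Cayley transform, removes the term `n = 0`, so the discrete form solves a Stein equation. The
substitution `f = (1 - A)* h` turns one equation into the other (`isLyapunov_iff_isStein`).
Conversely, any solution `‖T f‖²` dominates the form of its orbit, since partial integrals and
partial sums telescope to `‖T f‖²` minus a nonnegative remainder. So each form bounds the other,
without any decay of the remainders, and they agree. Summing over `I` keeps the frame constants. It
remains that a semi-continuous frame forces `1 ∉ σ(A)`: its form decreases along `exp(s A*)`, so the
semigroup is bounded, whereas `1 ∈ σ(A)` would put `eⁿ` in `σ(exp(n A))`. -/

section Lyapunov

variable {H : Type*} [NormedAddCommGroup H] [InnerProductSpace ℂ H]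

lemma enorm_sq_eq_ofReal {E : Type*} [SeminormedAddCommGroup E] (x : E) :
    ‖x‖ₑ ^ 2 = ENNReal.ofReal (‖x‖ ^ 2) := by
  rw [← ofReal_norm, ENNReal.ofReal_pow (norm_nonneg x)]

/-- The analysis operator of a Bessel family indexed by a measure space. -/
lemma exists_analysis_operator {α : Type*} [MeasurableSpace α] (ν : Measure α) (v : α → H)
    (hv : ∀ f : H, AEStronglyMeasurable (fun t => ⟪v t, f⟫_ℂ) ν) (C : ℝ≥0)
    (hC : ∀ f : H, ∫⁻ t, ‖⟪f, v t⟫_ℂ‖ₑ ^ 2 ∂ν ≤ C * ‖f‖ₑ ^ 2) :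
    ∃ T : H →L[ℂ] Lp ℂ 2 ν, ∀ f, ‖T f‖ₑ ^ 2 = ∫⁻ t, ‖⟪f, v t⟫_ℂ‖ₑ ^ 2 ∂ν := by
  -- The inner product is flipped to be linear in `f`; only its modulus matters.
  have hnorm : ∀ f : H, eLpNorm (fun t => ⟪v t, f⟫_ℂ) 2 ν ^ 2
      = ∫⁻ t, ‖⟪f, v t⟫_ℂ‖ₑ ^ 2 ∂ν := by
    intro f
    rw [eLpNorm_eq_lintegral_rpow_enorm_toReal (by norm_num) (by norm_num), ← ENNReal.rpow_natCast,
      ← ENNReal.rpow_mul]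
    norm_num
    refine lintegral_congr fun t => ?_
    rw [← ofReal_norm, ← ofReal_norm, norm_inner_symm]
  have hmem : ∀ f : H, MemLp (fun t => ⟪v t, f⟫_ℂ) 2 ν := by
    refine fun f => ⟨hv f, ?_⟩
    have h : eLpNorm (fun t => ⟪v t, f⟫_ℂ) 2 ν ^ 2 < ∞ := by
      rw [hnorm]
      exact (hC f).trans_lt (ENNReal.mul_lt_top ENNReal.coe_lt_top (by simp))
    simpa using h
  let T₀ : H →ₗ[ℂ] Lp ℂ 2 ν :=
    { toFun := fun f => (hmem f).toLp _
      map_add' := fun f h => by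
        rw [← MemLp.toLp_add]
        exact MemLp.toLp_congr _ _ (.of_forall fun t => inner_add_right _ _ _)
      map_smul' := fun c f => by
        rw [RingHom.id_apply, ← MemLp.toLp_const_smul]
        exact MemLp.toLp_congr _ _ (.of_forall fun t => inner_smul_right _ _ _) }
  have hT₀ : ∀ f, ‖T₀ f‖ₑ ^ 2 = ∫⁻ t, ‖⟪f, v t⟫_ℂ‖ₑ ^ 2 ∂ν := fun f => by
    rw [← hnorm, ← Lp.enorm_toLp (hmem f)]; rfl
  refine ⟨T₀.mkContinuous (Real.sqrt C) fun f => ?_, hT₀⟩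
  have h := (hT₀ f).trans_le (hC f)
  rw [enorm_sq_eq_ofReal, enorm_sq_eq_ofReal, ← ENNReal.ofReal_coe_nnreal,
    ← ENNReal.ofReal_mul C.coe_nonneg, ENNReal.ofReal_le_ofReal_iff (by positivity)] at h
  refine le_of_sq_le_sq ?_ (by positivity)
  rwa [mul_pow, Real.sq_sqrt C.coe_nonneg]

/-! ### Cayley transform and semigroup -/

lemma one_sub_mul_cayleyOp (A : H →L[ℂ] H) (hA : IsUnit (1 - A)) :
    (1 - A) * cayleyOp (-A) = 1 + A := by
  have hc : Commute (1 - A) (1 + A) := by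
    simp only [Commute, SemiconjBy]; noncomm_ring
  rw [cayleyOp, sub_neg_eq_add, ← sub_eq_add_neg, ← mul_assoc, hc.eq, mul_assoc,
    Ring.mul_inverse_cancel _ hA, mul_one]

lemma neg_one_mem_spectrum_neg_iff (A : H →L[ℂ] H) :
    (-1 : ℂ) ∈ spectrum ℂ (-A) ↔ (1 : ℂ) ∈ spectrum ℂ A := by
  rw [← spectrum.neg_eq, Set.mem_neg, neg_neg]

lemma isUnit_one_sub_iff (A : H →L[ℂ] H) :
    IsUnit (1 - A) ↔ (-1 : ℂ) ∉ spectrum ℂ (-A) := by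
  rw [neg_one_mem_spectrum_neg_iff, spectrum.notMem_iff, map_one]

variable [CompleteSpace H]

lemma star_exp_smul (A : H →L[ℂ] H) (t : ℝ) :
    star (NormedSpace.exp (t • A)) = NormedSpace.exp (t • star A) := by
  have h : star (t • A) = t • star A := by
    rw [← Complex.coe_smul t A, star_smul, ← Complex.coe_smul t (star A)]
    simp
  rw [NormedSpace.star_exp, h]

lemma inner_exp_smul (A : H →L[ℂ] H) (t : ℝ) (f g : H) :
    ⟪f, NormedSpace.exp (t • A) g⟫_ℂ = ⟪NormedSpace.exp (t • star A) f, g⟫_ℂ := by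
  rw [← star_exp_smul, ContinuousLinearMap.star_eq_adjoint, ContinuousLinearMap.adjoint_inner_left]

lemma exp_add_smul (A : H →L[ℂ] H) (s t : ℝ) :
    NormedSpace.exp ((s + t) • A) = NormedSpace.exp (s • A) * NormedSpace.exp (t • A) := by
  let _ : NormedAlgebra ℚ (H →L[ℂ] H) := NormedAlgebra.restrictScalars ℚ ℝ _
  rw [add_smul, NormedSpace.exp_add_of_commute (((Commute.refl A).smul_left s).smul_right t)]

lemma hasDerivAt_exp_smul_apply (B : H →L[ℂ] H) (f : H) (t : ℝ) :
    HasDerivAt (fun u : ℝ => NormedSpace.exp (u • B) f) (B (NormedSpace.exp (t • B) f)) t := by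
  have h := hasDerivAt_exp_smul_const' (𝕂 := ℝ) B t
  exact (((ContinuousLinearMap.apply ℂ H f).restrictScalars ℝ).hasFDerivAt.comp_hasDerivAt t h)

lemma continuous_exp_smul_apply (B : H →L[ℂ] H) (f : H) :
    Continuous fun u : ℝ => NormedSpace.exp (u • B) f :=
  continuous_iff_continuousAt.2 fun t => (hasDerivAt_exp_smul_apply B f t).continuousAt

lemma continuous_inner_exp_smul (A : H →L[ℂ] H) (f g : H) :
    Continuous fun t : ℝ => ⟪f, NormedSpace.exp (t • A) g⟫_ℂ :=
  continuous_const.inner (continuous_exp_smul_apply A g)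

variable {K : Type*} [NormedAddCommGroup K] [InnerProductSpace ℂ K]

/-! ### Lyapunov and Stein equations -/

lemma hasDerivAt_norm_sq_exp_smul (T : H →L[ℂ] K) (B : H →L[ℂ] H) (f : H) (t : ℝ) :
    HasDerivAt (fun u : ℝ => ‖T (NormedSpace.exp (u • B) f)‖ ^ 2)
      (2 * (⟪T (NormedSpace.exp (t • B) f), T (B (NormedSpace.exp (t • B) f))⟫_ℂ).re) t := by
  let _ : InnerProductSpace ℝ K := InnerProductSpace.rclikeToReal ℂ K
  have h : HasDerivAt (fun u : ℝ => T (NormedSpace.exp (u • B) f))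
      (T (B (NormedSpace.exp (t • B) f))) t :=
    (T.restrictScalars ℝ).hasFDerivAt.comp_hasDerivAt t (hasDerivAt_exp_smul_apply B f t)
  exact h.norm_sq

/-- The Lyapunov equation `A Q + Q A* = -g ⊗ g` for `Q = T* T`, as an identity of quadratic
forms. -/
def IsLyapunov (T : H →L[ℂ] K) (A : H →L[ℂ] H) (g : H) : Prop :=
  ∀ h : H, -(2 * (⟪T h, T (star A h)⟫_ℂ).re) = ‖⟪h, g⟫_ℂ‖ ^ 2

/-- `Q - C Q C* = a ⊗ a` for `Q = T* T`, as an identity of quadratic forms. -/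
def IsStein (T : H →L[ℂ] K) (C : H →L[ℂ] H) (a : H) : Prop :=
  ∀ f : H, ‖T f‖ ^ 2 - ‖T (star C f)‖ ^ 2 = ‖⟪f, a⟫_ℂ‖ ^ 2

/-- With `f = (1 - A)* h` one has `C* f = (1 + A)* h`, so the Stein difference is `‖T(h - A* h)‖² -
‖T(h + A* h)‖² = -4 Re ⟪T h, T A* h⟫`. The factor `√2` in `a` absorbs the remaining 2. -/
lemma isLyapunov_iff_isStein (T : H →L[ℂ] K) (A : H →L[ℂ] H) (hA : IsUnit (1 - A)) (g : H) :
    IsLyapunov T A g ↔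
      IsStein T (cayleyOp (-A)) (((Real.sqrt 2 : ℝ) : ℂ) • Ring.inverse (1 + -A) g) := by
  have hC : ∀ h, star (cayleyOp (-A)) (star (1 - A) h) = h + star A h := by
    intro h
    rw [← mul_apply_eq_comp, ← star_mul, one_sub_mul_cayleyOp A hA]
    simp
  have hinner : ∀ h : H, ‖⟪star (1 - A) h,
      ((Real.sqrt 2 : ℝ) : ℂ) • Ring.inverse (1 + -A) g⟫_ℂ‖ ^ 2 = 2 * ‖⟪h, g⟫_ℂ‖ ^ 2 := by
    intro h
    rw [ContinuousLinearMap.star_eq_adjoint, ContinuousLinearMap.adjoint_inner_left, map_smul,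
      ← mul_apply_eq_comp, ← sub_eq_add_neg, Ring.mul_inverse_cancel _ hA,
      inner_smul_right, norm_mul, mul_pow]
    simp
  have hpar : ∀ h : H, ‖T (star (1 - A) h)‖ ^ 2 - ‖T (star (cayleyOp (-A)) (star (1 - A) h))‖ ^ 2
      = 2 * -(2 * (⟪T h, T (star A h)⟫_ℂ).re) := by
    intro h
    rw [hC, star_sub, star_one, sub_apply, one_apply_eq_self,
      map_sub, map_add, @norm_sub_sq ℂ, @norm_add_sq ℂ]
    simp only [RCLike.re_to_complex]
    ring
  constructor
  · intro hL f
    obtain ⟨h, rfl⟩ : ∃ h, star (1 - A) h = f := by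
      refine ⟨Ring.inverse (star (1 - A)) f, ?_⟩
      rw [← mul_apply_eq_comp, Ring.mul_inverse_cancel _ hA.star,
        one_apply_eq_self]
    rw [hpar, hinner, hL h]
  · intro hS h
    have := hS (star (1 - A) h)
    rw [hpar, hinner] at this
    linarith

/-! ### Discrete orbits -/

lemma inner_pow_apply (C : H →L[ℂ] H) (n : ℕ) (f a : H) :
    ⟪f, (C ^ n) a⟫_ℂ = ⟪(star C ^ n) f, a⟫_ℂ := by
  rw [← star_pow, ContinuousLinearMap.star_eq_adjoint, ContinuousLinearMap.adjoint_inner_left]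

lemma IsStein.tsum_le {T : H →L[ℂ] K} {C : H →L[ℂ] H} {a : H} (hT : IsStein T C a) (f : H) :
    ∑' n : ℕ, ‖⟪f, (C ^ n) a⟫_ℂ‖ₑ ^ 2 ≤ ‖T f‖ₑ ^ 2 := by
  have hsum : ∀ N, ∑ n ∈ Finset.range N, ‖⟪f, (C ^ n) a⟫_ℂ‖ ^ 2
      = ‖T f‖ ^ 2 - ‖T ((star C ^ N) f)‖ ^ 2 := by
    intro N
    induction N with
    | zero => simp
    | succ N ih =>
      rw [Finset.sum_range_succ, ih, inner_pow_apply, ← hT, pow_succ' (star C),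
        mul_apply_eq_comp]
      ring
  rw [ENNReal.tsum_eq_iSup_nat]
  refine iSup_le fun N => ?_
  simp only [enorm_sq_eq_ofReal]
  rw [← ENNReal.ofReal_sum_of_nonneg fun n _ => by positivity, hsum]
  exact ENNReal.ofReal_le_ofReal (sub_le_self _ (by positivity))

lemma isStein_of_tsum_eq {T : H →L[ℂ] K} {C : H →L[ℂ] H} {a : H}
    (hT : ∀ f, ‖T f‖ₑ ^ 2 = ∑' n : ℕ, ‖⟪f, (C ^ n) a⟫_ℂ‖ₑ ^ 2) : IsStein T C a := by
  intro f
  have h := hT f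
  rw [tsum_eq_zero_add' ENNReal.summable] at h
  have hshift : ∀ n, ‖⟪f, (C ^ (n + 1)) a⟫_ℂ‖ₑ ^ 2 = ‖⟪star C f, (C ^ n) a⟫_ℂ‖ₑ ^ 2 := by
    intro n
    rw [inner_pow_apply, inner_pow_apply, pow_succ (star C), mul_apply_eq_comp]
  simp only [hshift] at h
  rw [← hT (star C f), pow_zero, one_apply_eq_self] at h
  simp only [enorm_sq_eq_ofReal] at h
  rw [← ENNReal.ofReal_add (by positivity) (by positivity),
    ENNReal.ofReal_eq_ofReal_iff (by positivity) (by positivity)] at h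
  linarith

/-! ### Continuous orbits -/

lemma setLIntegral_Ico_inner_exp (A : H →L[ℂ] H) (f g : H) {s : ℝ} (hs : 0 ≤ s) :
    ∫⁻ t in Set.Ico 0 s, ‖⟪f, NormedSpace.exp (t • A) g⟫_ℂ‖ₑ ^ 2
      = ENNReal.ofReal (∫ t in (0 : ℝ)..s, ‖⟪f, NormedSpace.exp (t • A) g⟫_ℂ‖ ^ 2) := by
  have hc : Continuous fun t : ℝ => ‖⟪f, NormedSpace.exp (t • A) g⟫_ℂ‖ ^ 2 :=
    (continuous_inner_exp_smul A f g).norm.pow 2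
  rw [intervalIntegral.integral_of_le hs, ofReal_integral_eq_lintegral_ofReal
    (hc.integrableOn_Icc.mono_set Set.Ioc_subset_Icc_self)
    (.of_forall fun t => by positivity)]
  simp only [enorm_sq_eq_ofReal]
  exact setLIntegral_congr Ico_ae_eq_Ioc

lemma IsLyapunov.integral_eq {T : H →L[ℂ] K} {A : H →L[ℂ] H} {g : H} (hT : IsLyapunov T A g)
    (f : H) (s : ℝ) : ∫ t in (0 : ℝ)..s, ‖⟪f, NormedSpace.exp (t • A) g⟫_ℂ‖ ^ 2
      = ‖T f‖ ^ 2 - ‖T (NormedSpace.exp (s • star A) f)‖ ^ 2 := by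
  have hc : Continuous fun t : ℝ => ‖⟪f, NormedSpace.exp (t • A) g⟫_ℂ‖ ^ 2 :=
    (continuous_inner_exp_smul A f g).norm.pow 2
  have hd : ∀ t : ℝ, HasDerivAt (fun u : ℝ => -‖T (NormedSpace.exp (u • star A) f)‖ ^ 2)
      (‖⟪f, NormedSpace.exp (t • A) g⟫_ℂ‖ ^ 2) t := by
    intro t
    rw [inner_exp_smul, ← hT]
    exact (hasDerivAt_norm_sq_exp_smul T (star A) f t).neg
  rw [intervalIntegral.integral_eq_sub_of_hasDerivAt (fun t _ => hd t)
    (hc.intervalIntegrable _ _)]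
  simp
  ring

lemma IsLyapunov.lintegral_le {T : H →L[ℂ] K} {A : H →L[ℂ] H} {g : H} (hT : IsLyapunov T A g)
    (f : H) :
    ∫⁻ t in Set.Ici (0 : ℝ), ‖⟪f, NormedSpace.exp (t • A) g⟫_ℂ‖ₑ ^ 2 ≤ ‖T f‖ₑ ^ 2 := by
  have hU : Set.Ici (0 : ℝ) = ⋃ n : ℕ, Set.Ico (0 : ℝ) n := by
    ext t
    simp only [Set.mem_Ici, Set.mem_iUnion, Set.mem_Ico, exists_and_left, iff_self_and]
    exact fun _ => exists_nat_gt t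
  rw [hU, setLIntegral_iUnion_of_directed _ (Monotone.directed_le fun m n hmn =>
    Set.Ico_subset_Ico_right (Nat.cast_le.2 hmn))]
  refine iSup_le fun n => ?_
  rw [setLIntegral_Ico_inner_exp A f g n.cast_nonneg, hT.integral_eq, enorm_sq_eq_ofReal]
  exact ENNReal.ofReal_le_ofReal (sub_le_self _ (by positivity))

lemma setLIntegral_Ici_inner_exp_shift (A : H →L[ℂ] H) (f g : H) (s : ℝ) :
    ∫⁻ t in Set.Ici s, ‖⟪f, NormedSpace.exp (t • A) g⟫_ℂ‖ₑ ^ 2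
      = ∫⁻ t in Set.Ici (0 : ℝ),
          ‖⟪NormedSpace.exp (s • star A) f, NormedSpace.exp (t • A) g⟫_ℂ‖ₑ ^ 2 := by
  have hm : Measurable fun t : ℝ => ‖⟪f, NormedSpace.exp (t • A) g⟫_ℂ‖ₑ ^ 2 :=
    (continuous_inner_exp_smul A f g).enorm.measurable.pow_const 2
  rw [← (measurePreserving_add_left volume s).setLIntegral_comp_preimage measurableSet_Ici hm,
    Set.preimage_const_add_Ici, sub_self]
  refine lintegral_congr fun t => ?_
  rw [← inner_exp_smul, exp_add_smul, mul_apply_eq_comp]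

lemma lintegral_Ici_eq_add (A : H →L[ℂ] H) (f g : H) {s : ℝ} (hs : 0 ≤ s) :
    ∫⁻ t in Set.Ici (0 : ℝ), ‖⟪f, NormedSpace.exp (t • A) g⟫_ℂ‖ₑ ^ 2
      = ENNReal.ofReal (∫ t in (0 : ℝ)..s, ‖⟪f, NormedSpace.exp (t • A) g⟫_ℂ‖ ^ 2)
        + ∫⁻ t in Set.Ici (0 : ℝ),
          ‖⟪NormedSpace.exp (s • star A) f, NormedSpace.exp (t • A) g⟫_ℂ‖ₑ ^ 2 := by
  rw [← setLIntegral_Ico_inner_exp A f g hs, ← setLIntegral_Ici_inner_exp_shift,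
    ← lintegral_union measurableSet_Ici, Set.Ico_union_Ici_eq_Ici hs]
  exact Set.disjoint_left.2 fun t ht ht' => absurd ht.2 (not_lt.2 ht')

lemma isLyapunov_of_lintegral_eq {T : H →L[ℂ] K} {A : H →L[ℂ] H} {g : H}
    (hT : ∀ f, ‖T f‖ₑ ^ 2
      = ∫⁻ t in Set.Ici (0 : ℝ), ‖⟪f, NormedSpace.exp (t • A) g⟫_ℂ‖ₑ ^ 2) :
    IsLyapunov T A g := by
  intro f
  have hc : Continuous fun t : ℝ => ‖⟪f, NormedSpace.exp (t • A) g⟫_ℂ‖ ^ 2 :=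
    (continuous_inner_exp_smul A f g).norm.pow 2
  have heq : ∀ s ∈ Set.Ici (0 : ℝ), ‖T f‖ ^ 2 - ‖T (NormedSpace.exp (s • star A) f)‖ ^ 2
      = ∫ t in (0 : ℝ)..s, ‖⟪f, NormedSpace.exp (t • A) g⟫_ℂ‖ ^ 2 := by
    intro s hs
    have hn := intervalIntegral.integral_nonneg (μ := volume) (Set.mem_Ici.1 hs)
      fun t _ => sq_nonneg ‖⟪f, NormedSpace.exp (t • A) g⟫_ℂ‖
    have h := hT f
    rw [lintegral_Ici_eq_add A f g hs, ← hT, enorm_sq_eq_ofReal, enorm_sq_eq_ofReal,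
      ← ENNReal.ofReal_add hn (by positivity),
      ENNReal.ofReal_eq_ofReal_iff (by positivity) (by positivity)] at h
    linarith
  -- `heq` holds only for `s ≥ 0`, so one-sided derivatives at `0` are compared.
  have h₁ := ((hasDerivAt_norm_sq_exp_smul T (star A) f 0).const_sub
    (‖T f‖ ^ 2)).hasDerivWithinAt (s := Set.Ici 0)
  have h₂ := (intervalIntegral.integral_hasDerivAt_right (hc.intervalIntegrable 0 0)
    hc.stronglyMeasurable.stronglyMeasurableAtFilter hc.continuousAt).hasDerivWithinAt
    (s := Set.Ici 0)
  have h := (uniqueDiffWithinAt_Ici (0 : ℝ)).eq_deriv _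
    (h₁.congr (fun s hs => (heq s hs).symm) (heq 0 Set.self_mem_Ici).symm) h₂
  simpa using h

/-- The orbit of `g` under the semigroup and the orbit of `√2 (1 - A)⁻¹ g` under the Cayley
transform have the same frame form, as soon as one of the two is bounded. -/
theorem lintegral_exp_eq_tsum_cayleyOp (A : H →L[ℂ] H) (hA : IsUnit (1 - A)) (g : H) (C : ℝ≥0)
    (hC : (∀ f, ∫⁻ t in Set.Ici (0 : ℝ), ‖⟪f, NormedSpace.exp (t • A) g⟫_ℂ‖ₑ ^ 2
          ≤ C * ‖f‖ₑ ^ 2) ∨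
      ∀ f, ∑' n : ℕ, ‖⟪f, (cayleyOp (-A) ^ n)
        (((Real.sqrt 2 : ℝ) : ℂ) • Ring.inverse (1 + -A) g)⟫_ℂ‖ₑ ^ 2 ≤ C * ‖f‖ₑ ^ 2) (f : H) :
    ∫⁻ t in Set.Ici (0 : ℝ), ‖⟪f, NormedSpace.exp (t • A) g⟫_ℂ‖ₑ ^ 2
      = ∑' n : ℕ, ‖⟪f, (cayleyOp (-A) ^ n)
        (((Real.sqrt 2 : ℝ) : ℂ) • Ring.inverse (1 + -A) g)⟫_ℂ‖ₑ ^ 2 := by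
  set a : H := ((Real.sqrt 2 : ℝ) : ℂ) • Ring.inverse (1 + -A) g with ha
  have hd : (∀ f, ∫⁻ t in Set.Ici (0 : ℝ), ‖⟪f, NormedSpace.exp (t • A) g⟫_ℂ‖ₑ ^ 2
        ≤ C * ‖f‖ₑ ^ 2) → ∀ f, ∑' n : ℕ, ‖⟪f, (cayleyOp (-A) ^ n) a⟫_ℂ‖ₑ ^ 2
      ≤ ∫⁻ t in Set.Ici (0 : ℝ), ‖⟪f, NormedSpace.exp (t • A) g⟫_ℂ‖ₑ ^ 2 := by
    intro h f
    obtain ⟨T, hT⟩ := exists_analysis_operator (volume.restrict (Set.Ici (0 : ℝ)))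
      (fun t => NormedSpace.exp (t • A) g) (fun f =>
        ((continuous_exp_smul_apply A g).inner continuous_const).aestronglyMeasurable) C h
    rw [← hT]
    exact ((isLyapunov_iff_isStein T A hA g).1 (isLyapunov_of_lintegral_eq hT)).tsum_le f
  have hc : (∀ f, ∑' n : ℕ, ‖⟪f, (cayleyOp (-A) ^ n) a⟫_ℂ‖ₑ ^ 2 ≤ C * ‖f‖ₑ ^ 2) →
      ∀ f, ∫⁻ t in Set.Ici (0 : ℝ), ‖⟪f, NormedSpace.exp (t • A) g⟫_ℂ‖ₑ ^ 2
      ≤ ∑' n : ℕ, ‖⟪f, (cayleyOp (-A) ^ n) a⟫_ℂ‖ₑ ^ 2 := by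
    intro h f
    obtain ⟨T, hT⟩ := exists_analysis_operator (Measure.count : Measure ℕ)
      (fun n => (cayleyOp (-A) ^ n) a) (fun f =>
        (measurable_of_countable _).aestronglyMeasurable) C (by simpa only [lintegral_count] using h)
    simp only [lintegral_count] at hT
    rw [← hT]
    exact ((isLyapunov_iff_isStein T A hA g).2 (isStein_of_tsum_eq hT)).lintegral_le f
  rcases hC with h | h
  -- The assumed bound first passes to the other orbit, which then has an analysis operator too.
  · exact le_antisymm (hc (fun f => (hd h f).trans (h f)) f) (hd h f)
  · exact le_antisymm (hc h f) (hd (fun f => (hc h f).trans (h f)) f)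

/-! ### Boundedness of the semigroup and the spectrum -/

lemma norm_exp_star_le_of_isSemiContinuousFrame (A : H →L[ℂ] H) {I : Type*} (g : I → H)
    (h : IsSemiContinuousFrame (fun (i : I) (t : ℝ) => NormedSpace.exp (t • A) (g i))) :
    ∃ M : ℝ, ∀ s : ℝ, 0 ≤ s → ‖NormedSpace.exp (s • star A)‖ ≤ M := by
  obtain ⟨c, C, hc, -, h⟩ := h
  refine ⟨Real.sqrt (C / c), fun s hs => ContinuousLinearMap.opNorm_le_bound _ (by positivity)
    fun f => ?_⟩
  -- The form at `exp(s A*) f` is a tail of the form at `f`; comparing frame bounds gives `√(C /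
  -- c)`.
  have hle : ∑' i, ∫⁻ t in Set.Ici (0 : ℝ),
      ‖⟪NormedSpace.exp (s • star A) f, NormedSpace.exp (t • A) (g i)⟫_ℂ‖ₑ ^ 2
      ≤ ∑' i, ∫⁻ t in Set.Ici (0 : ℝ), ‖⟪f, NormedSpace.exp (t • A) (g i)⟫_ℂ‖ₑ ^ 2 :=
    ENNReal.tsum_le_tsum fun i => by
      rw [lintegral_Ici_eq_add A f (g i) hs]
      exact le_add_self
  have h' := ((h _).1.trans hle).trans (h f).2
  rw [enorm_sq_eq_ofReal, enorm_sq_eq_ofReal, ← ENNReal.ofReal_coe_nnreal,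
    ← ENNReal.ofReal_coe_nnreal, ← ENNReal.ofReal_mul c.coe_nonneg, ← ENNReal.ofReal_mul C.coe_nonneg,
    ENNReal.ofReal_le_ofReal_iff (by positivity)] at h'
  refine le_of_sq_le_sq ?_ (by positivity)
  have hc' : (0 : ℝ) < c := hc
  rw [mul_pow, Real.sq_sqrt (by positivity), div_mul_eq_mul_div, le_div_iff₀ hc']
  linarith

lemma isUnit_one_sub_of_isSemiContinuousFrame (A : H →L[ℂ] H) {I : Type*} (g : I → H)
    (h : IsSemiContinuousFrame (fun (i : I) (t : ℝ) => NormedSpace.exp (t • A) (g i))) :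
    IsUnit (1 - A) := by
  rw [isUnit_one_sub_iff, neg_one_mem_spectrum_neg_iff]
  intro h₁
  obtain ⟨M, hM⟩ := norm_exp_star_le_of_isSemiContinuousFrame A g h
  have hb : ∀ n : ℕ, Real.exp n ≤ M := by
    intro n
    have hmem : (n : ℂ) ∈ spectrum ℂ ((n : ℝ) • A) := by
      rcases n.eq_zero_or_pos with rfl | hn
      -- For `n = 0` the operator is `0`, whose spectrum contains `0` only in a nontrivial algebra.
      · have : Nontrivial (H →L[ℂ] H) := by
          by_contra hne
          rw [not_nontrivial_iff_subsingleton] at hne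
          simp [spectrum.of_subsingleton] at h₁
        simp
      · have := (spectrum.smul_mem_smul_iff (R := ℂ) (a := A) (s := 1)
          (r := Units.mk0 (n : ℂ) (by exact_mod_cast hn.ne'))).2 h₁
        simpa [Units.smul_def, ← Complex.coe_smul] using this
    have h₂ := spectrum.norm_le_norm_mul_of_mem (spectrum.exp_mem_exp _ hmem)
    rw [← norm_star (NormedSpace.exp ((n : ℝ) • A)), star_exp_smul, ← Complex.exp_eq_exp_ℂ,
      Complex.norm_exp, Complex.natCast_re] at h₂
    refine h₂.trans ((mul_le_of_le_one_right (norm_nonneg _) ?_).trans (hM n n.cast_nonneg))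
    exact ContinuousLinearMap.norm_id_le
  obtain ⟨n, hn⟩ := exists_nat_gt M
  exact absurd (hb n) (not_le.2 (hn.trans_le (by linarith [Real.add_one_le_exp (n : ℝ)])))

theorem isSemiContinuousFrame_exp_iff (A : H →L[ℂ] H) {I : Type*} (g : I → H) :
    IsSemiContinuousFrame (fun (i : I) (t : ℝ) => NormedSpace.exp (t • A) (g i)) ↔
      (-1 : ℂ) ∉ spectrum ℂ (-A) ∧
      IsFrame (fun q : I × ℕ => (cayleyOp (-A) ^ q.2)
        (((Real.sqrt 2 : ℝ) : ℂ) • Ring.inverse (1 + -A) (g q.1))) := by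
  have key : ∀ _ : IsUnit (1 - A), ∀ C : ℝ≥0,
      ((∀ f, ∑' i, ∫⁻ t in Set.Ici (0 : ℝ), ‖⟪f, NormedSpace.exp (t • A) (g i)⟫_ℂ‖ₑ ^ 2
          ≤ C * ‖f‖ₑ ^ 2) ∨
        ∀ f, ∑' q : I × ℕ, ‖⟪f, (cayleyOp (-A) ^ q.2)
          (((Real.sqrt 2 : ℝ) : ℂ) • Ring.inverse (1 + -A) (g q.1))⟫_ℂ‖ₑ ^ 2
            ≤ C * ‖f‖ₑ ^ 2) → ∀ f,
      ∑' i, ∫⁻ t in Set.Ici (0 : ℝ), ‖⟪f, NormedSpace.exp (t • A) (g i)⟫_ℂ‖ₑ ^ 2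
        = ∑' q : I × ℕ, ‖⟪f, (cayleyOp (-A) ^ q.2)
          (((Real.sqrt 2 : ℝ) : ℂ) • Ring.inverse (1 + -A) (g q.1))⟫_ℂ‖ₑ ^ 2 := by
    intro hA C hC f
    rw [ENNReal.tsum_prod (f := fun i n => ‖⟪f, (cayleyOp (-A) ^ n)
          (((Real.sqrt 2 : ℝ) : ℂ) • Ring.inverse (1 + -A) (g i))⟫_ℂ‖ₑ ^ 2)]
    refine tsum_congr fun i => lintegral_exp_eq_tsum_cayleyOp A hA (g i) C ?_ f
    refine hC.imp (fun h f => (ENNReal.le_tsum i).trans (h f)) fun h f => ?_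
    refine le_trans ?_ (h f)
    rw [ENNReal.tsum_prod (f := fun i n => ‖⟪f, (cayleyOp (-A) ^ n)
          (((Real.sqrt 2 : ℝ) : ℂ) • Ring.inverse (1 + -A) (g i))⟫_ℂ‖ₑ ^ 2)]
    exact ENNReal.le_tsum i
  constructor
  · intro h
    have hA := isUnit_one_sub_of_isSemiContinuousFrame A g h
    refine ⟨(isUnit_one_sub_iff A).1 hA, ?_⟩
    obtain ⟨c, C, hc, hC, h⟩ := h
    refine ⟨c, C, hc, hC, fun f => ?_⟩
    rw [← key hA C (.inl fun f => (h f).2)]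
    exact h f
  · rintro ⟨hA, c, C, hc, hC, h⟩
    refine ⟨c, C, hc, hC, fun f => ?_⟩
    rw [key ((isUnit_one_sub_iff A).2 hA) C (.inr fun f => (h f).2)]
    exact h f

end Lyapunov

/-! ### Transfer to the spectral representation -/

section Representation

variable {H : Type*} [NormedAddCommGroup H] [InnerProductSpace ℂ H]

lemma SpectralMultiplicityRep.ext_ae {B : H →L[ℂ] H} (R : SpectralMultiplicityRep B) {x y : H}
    (h : ∀ p, (R.U x p : ℂ → ℂ) =ᵐ[R.μ p.1] (R.U y p : ℂ → ℂ)) : x = y :=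
  R.U.injective (lp.ext (funext fun p => Lp.ext (h p)))

/-- If `1 + B` is injective, then `-1` is not an atom of the spectral measures. -/
lemma SpectralMultiplicityRep.measure_neg_one_eq_zero {B : H →L[ℂ] H}
    (R : SpectralMultiplicityRep B) (hB : Function.Injective ⇑(1 + B))
    (p : Σ j : Multiplicity, MultiplicityIndex j) : R.μ p.1 {-1} = 0 := by
  classical
  have hfin : R.μ p.1 {-1} ≠ ∞ := by
    have := R.regular p.1
    exact isCompact_singleton.measure_lt_top.ne
  let e : Lp ℂ 2 (R.μ p.1) := indicatorConstLp 2 (measurableSet_singleton (-1 : ℂ)) hfin 1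
  let x : H := R.U.symm (lp.single 2 p e)
  have hUx : R.U x = lp.single 2 p e := R.U.apply_symm_apply _
  have he : (e : ℂ → ℂ) =ᵐ[R.μ p.1] Set.indicator {-1} fun _ => 1 := indicatorConstLp_coeFn
  have hx : (1 + B) x = (1 + B) 0 := by
    rw [map_zero, add_apply, one_apply_eq_self,
      ← sub_neg_eq_add, sub_eq_zero]
    refine R.ext_ae fun q => ?_
    have hi := R.intertwines x q
    have hneg : (R.U (-B x) q : ℂ → ℂ) =ᵐ[R.μ q.1] fun z => -(R.U (B x) q : ℂ → ℂ) z := by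
      rw [map_neg]
      exact Lp.coeFn_neg _
    -- The indicator of `{-1}` is an eigenvector of multiplication by `z` with eigenvalue `-1`.
    have hz : (R.U x q : ℂ → ℂ) =ᵐ[R.μ q.1] fun z => -(z * (R.U x q : ℂ → ℂ) z) := by
      rw [hUx, lp.single_apply]
      rcases eq_or_ne q p with rfl | hq
      · rw [Pi.single_eq_same]
        filter_upwards [he] with z hz
        rw [hz]
        by_cases h : z = -1 <;> simp [h]
      · rw [Pi.single_eq_of_ne hq]
        filter_upwards [Lp.coeFn_zero ℂ 2 (R.μ q.1)] with z hz
        exact (hz.trans (by simp)).trans (congrArg (fun w => -(z * w)) hz).symm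
    filter_upwards [hi, hneg, hz] with z h₁ h₂ h₃
    rw [h₂, h₁, ← h₃]
  have h0 : e = 0 := by
    have : R.U x = 0 := by rw [hB hx, map_zero]
    rw [hUx] at this
    simpa using congrArg (fun w : MultiplicitySpace R.μ => w p) this
  rw [h0] at he
  have hae : ∀ᵐ z ∂(R.μ p.1), z ≠ -1 := by
    filter_upwards [he, Lp.coeFn_zero ℂ 2 (R.μ p.1)] with z h₁ h₂ hz
    rw [h₂] at h₁
    simp [hz] at h₁
  simpa [ae_iff] using hae

/-- In the representation `(1 + B) a = k g` reads `(1 + z) Ua = k Ug`, and division by `1 + z` is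
legitimate because `{-1}` is a null set. -/
lemma SpectralMultiplicityRep.ae_eq_div_iff {B : H →L[ℂ] H} (R : SpectralMultiplicityRep B)
    (hB : IsUnit (1 + B)) (k : ℂ) (g a : H) :
    (∀ p, (R.U a p : ℂ → ℂ) =ᵐ[R.μ p.1] fun z => k / (1 + z) * (R.U g p : ℂ → ℂ) z) ↔
      a = k • Ring.inverse (1 + B) g := by
  have hinj : Function.Injective ⇑(1 + B) := by
    intro x y h
    have := congrArg ⇑(Ring.inverse (1 + B)) h
    simpa only [← mul_apply_eq_comp, Ring.inverse_mul_cancel _ hB,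
      one_apply_eq_self] using this
  have hgen : ∀ b : H, (1 + B) b = k • g → ∀ p,
      (R.U b p : ℂ → ℂ) =ᵐ[R.μ p.1] fun z => k / (1 + z) * (R.U g p : ℂ → ℂ) z := by
    intro b hb p
    have h₁ : (R.U ((1 + B) b) p : ℂ → ℂ) =ᵐ[R.μ p.1]
        fun z => (R.U b p : ℂ → ℂ) z + (R.U (B b) p : ℂ → ℂ) z := by
      rw [add_apply, one_apply_eq_self, map_add]
      exact Lp.coeFn_add _ _
    have h₂ : (R.U (k • g) p : ℂ → ℂ) =ᵐ[R.μ p.1] fun z => k * (R.U g p : ℂ → ℂ) z := by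
      rw [map_smul]
      exact Lp.coeFn_smul _ _
    rw [hb] at h₁
    have h₃ : ∀ᵐ z ∂(R.μ p.1), z ≠ -1 := by
      simpa [ae_iff] using R.measure_neg_one_eq_zero hinj p
    filter_upwards [h₁, h₂, h₃, R.intertwines b p] with z e₁ e₂ hz e₃
    have hz' : 1 + z ≠ 0 := fun h => hz (by linear_combination h)
    rw [e₃] at e₁
    field_simp
    linear_combination e₂ - e₁
  have hsol : (1 + B) (k • Ring.inverse (1 + B) g) = k • g := by
    rw [map_smul, ← mul_apply_eq_comp, Ring.mul_inverse_cancel _ hB,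
      one_apply_eq_self]
  constructor
  · exact fun h => R.ext_ae fun p => (h p).trans (hgen _ hsol p).symm
  · rintro rfl
    exact hgen _ hsol

end Representation

theorem mainTheorem2 {H : Type*} [NormedAddCommGroup H] [InnerProductSpace ℂ H]
    [CompleteSpace H] [TopologicalSpace.SeparableSpace H]
    (A : H →L[ℂ] H) (hA : IsStarNormal A)
    {I : Type*} [Countable I] (g : I → H) :
    -- for every `U` as in the spectral theorem with multiplicity for `-A`
    (∀ R : SpectralMultiplicityRep (-A),
      IsSemiContinuousFrame (fun (i : I) (t : ℝ) => NormedSpace.exp (t • A) (g i)) ↔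
        (-1 : ℂ) ∉ spectrum ℂ (-A) ∧
        ∃ a : I → H,
          (∀ i p, (R.U (a i) p : ℂ → ℂ) =ᵐ[R.μ p.1]
            fun z => ((Real.sqrt 2 : ℝ) : ℂ) / (1 + z) * (R.U (g i) p : ℂ → ℂ) z) ∧
          IsFrame (fun q : I × ℕ => (cayleyOp (-A) ^ q.2) (a q.1))) ∧
    -- the same without reference to a representation
    (IsSemiContinuousFrame (fun (i : I) (t : ℝ) => NormedSpace.exp (t • A) (g i)) ↔
      (-1 : ℂ) ∉ spectrum ℂ (-A) ∧
      IsFrame (fun q : I × ℕ => (cayleyOp (-A) ^ q.2)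
        (((Real.sqrt 2 : ℝ) : ℂ) • Ring.inverse (1 + -A) (g q.1)))) := by
  refine ⟨fun R => ?_, isSemiContinuousFrame_exp_iff A g⟩
  rw [isSemiContinuousFrame_exp_iff]
  refine and_congr_right fun hs => ?_
  have hB : IsUnit (1 + -A) := by
    rw [← sub_eq_add_neg]
    exact (isUnit_one_sub_iff A).2 hs
  constructor
  · exact fun h => ⟨_, fun i => (R.ae_eq_div_iff hB _ (g i) _).2 rfl, h⟩
  · rintro ⟨a, ha, h⟩
    simpa only [fun i => (R.ae_eq_div_iff hB _ (g i) (a i)).1 (ha i)] using h
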